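/- **Online prize-collecting Steiner tree.** Let $G=(V,E)$ be a finite connected graph with edge costs $c_e\ge 0$, let $d$ be its shortest-path distance, and let $r\in V$ be a root. Requests arrive one by one; the $i$-th request consists of a terminal (a vertex, also denoted $i$) and a penalty $\pi_i\ge 0$. On each request an online algorithm must irrevocably either pay $\pi_i$, or add edges of $G$ to its current subgraph $H$ so that $H$ connects $i$ to $r$. With $P$ the set of requests whose penalty was paid, its total cost is $c(H)+\sum_{i\in P}\pi_i$, where $c(H)=\sum_{e\in H}c_e$. Let $X$ be the set consisting of $r$ and all vertices that occur as terminals, let $k=|X|$, and let $\mathrm{OPT}$ be the minimum over all subgraphs $H$ of $G$ of $c(H)$ plus the penalties of all requests whose terminal is not connected to $r$ in $H$. **HST embeddings.** An (expanding) HST embedding $T$ of $(X,d)$ is a finite rooted tree with edge lengths such that: the leaves of $T$ are exactly the points of $X$; all edge lengths are (integer) powers of $2$; the edges from a node to its children all have the same length; edge lengths decrease by a factor of $2$ at each step along every root-to-leaf path; if an edge has length $2^{j-1}$ and separates both $u,v\in X$ from the root of the tree, then $d(u,v)<2^j$; and the tree distance satisfies $T(u,v)\ge d(u,v)$ for all $u,v\in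 X$. $\mathrm{OPT}(T)$ denotes the optimum of the same instance (root $r$, same terminals and penalties) on the weighted tree $T$. **Algorithm.** Maintain a set $Z$ of buy terminals, initially $Z=\{r\}$, and a cost share $\rho_i$ for each request. When $i$ arrives with penalty $\pi_i$, let $z\in Z$ be closest to $i$ (ties broken in favour of the vertex that entered $Z$ first) and let $a_i=d(i,z)$. If $a_i=0$, put $i$ into $Z$ and connect $i$ to $z$ at cost $0$. Otherwise $i$ is of class $j$, where $a_i\in[2^j,2^{j+1})$, $j\in\mathbb Z$; let $W(i)$ be the set of requests of class $j$ that arrived so far (including $i$ itself) with $d(i,i')<2^{j-1}$, and raise $\rho_i$ from $0$ until $\sum_{i'\in W(i)}\rho_{i'}\ge 2^{j+1}$ or $\rho_i=\pi_i$. If $\sum_{i'\in W(i)}\rho_{i'}\ge 2^{j+1}$, put $i$ into $Z$ and add the edges of a shortest path from $i$ to $z$ to $H$; otherwise pay $\pi_i$. **Theorem 5.** This is a deterministic $O(\log k)$-competitive online algorithm for prize-collecting Steiner tree. Precisely, there is a universal constant $C>0$ such that for every such graph, every root and every finite request sequence the algorithm produces a valid solution online (each terminal whose penalty is not paid is connected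 to $r$ in $H$ as soon as it has been served), its total cost is at most $C\cdot\mathrm{OPT}(T)$ for every HST embedding $T$ of $(X,d)$, and its total cost is at most $C\log k\cdot\mathrm{OPT}$. -/

import Mathlib

noncomputable section

open scoped Classical

namespace PCST

/-- A finite connected undirected graph with non-negative edge costs. -/
structure Network (V : Type*) [Fintype V] where
  graph : SimpleGraph V
  connected : graph.Connected
  weight : Sym2 V → ℝ
  weight_nonneg : ∀ e, 0 ≤ weight e

/-- A request: a terminal (a vertex of the graph) together with its penalty. -/
structure Request (V : Type*) where
  vertex : V
  penalty : ℝ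
  penalty_nonneg : 0 ≤ penalty

/-- Move a request along a map of the vertices, keeping its penalty. -/
def Request.map {V M : Type*} (f : V → M) (q : Request V) : Request M :=
  ⟨f q.vertex, q.penalty, q.penalty_nonneg⟩

namespace Network

variable {V : Type*} [Fintype V]

/-- The length of a walk. -/
def walkLength (N : Network V) {u v : V} (p : N.graph.Walk u v) : ℝ :=
  (p.edges.map N.weight).sum

/-- The shortest-path distance. -/
def dist (N : Network V) (u v : V) : ℝ :=
  ⨅ p : N.graph.Walk u v, N.walkLength p

theorem walkLength_nonneg (N : Network V) {u v : V} (p : N.graph.Walk u v) :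
    0 ≤ N.walkLength p := by
  apply List.sum_nonneg
  intro x hx
  obtain ⟨e, -, rfl⟩ := List.mem_map.1 hx
  exact N.weight_nonneg e

theorem walkLength_bypass_le (N : Network V) {u v : V} (p : N.graph.Walk u v) :
    N.walkLength p.bypass ≤ N.walkLength p := by
  induction p with
  | nil => simp [SimpleGraph.Walk.bypass]
  | @cons a b c h p ih =>
    simp only [SimpleGraph.Walk.bypass]
    have h2 : N.walkLength (SimpleGraph.Walk.cons h p) = N.weight s(a, b) + N.walkLength p := by
      simp [walkLength]
    split_ifs with hs
    · have h1 : N.walkLength (p.bypass.dropUntil a hs) ≤ N.walkLength p.bypass := by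
        conv_rhs => rw [← p.bypass.take_spec hs]
        have := N.walkLength_nonneg (p.bypass.takeUntil a hs)
        simp only [walkLength, SimpleGraph.Walk.edges_append, List.map_append,
          List.sum_append] at this ⊢
        linarith
      have := N.weight_nonneg s(a, b)
      linarith
    · have h3 : N.walkLength (SimpleGraph.Walk.cons h p.bypass)
          = N.weight s(a, b) + N.walkLength p.bypass := by
        simp [walkLength]
      linarith

/-- Shortest paths exist. -/
theorem exists_shortestPath (N : Network V) (u v : V) :
    ∃ p : N.graph.Walk u v, p.IsPath ∧ N.walkLength p = N.dist u v := by
  have hfin : Finite (N.graph.Path u v) := inferInstance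
  have : Nonempty (N.graph.Path u v) := by
    obtain ⟨p⟩ := N.connected.preconnected u v
    exact ⟨p.toPath⟩
  have : Nonempty (N.graph.Walk u v) := N.connected.preconnected u v
  obtain ⟨p, hp⟩ := Finite.exists_min (fun p : N.graph.Path u v => N.walkLength p.1)
  refine ⟨p.1, p.2, le_antisymm ?_ ?_⟩
  · apply le_ciInf
    intro q
    exact (hp ⟨q.bypass, q.bypass_isPath⟩).trans (N.walkLength_bypass_le q)
  · apply ciInf_le
    exact ⟨0, by rintro _ ⟨q, rfl⟩; exact N.walkLength_nonneg q⟩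

/-- The edges of a (fixed) shortest path from `u` to `v`. -/
def shortestPathEdges (N : Network V) (u v : V) : Finset (Sym2 V) :=
  (N.exists_shortestPath u v).choose.edges.toFinset

/-- The set of all edges. -/
def edges (N : Network V) : Finset (Sym2 V) :=
  Finset.univ.filter (fun e => e ∈ N.graph.edgeSet)

/-- The cost `c(H)` of a set of edges. -/
def edgeCost (N : Network V) (H : Finset (Sym2 V)) : ℝ := ∑ e ∈ H, N.weight e

end Network

/-- `u` and `v` are connected in the subgraph with edge set `H`. -/
def ConnectedIn {V : Type*} (H : Finset (Sym2 V)) (u v : V) : Prop :=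
  (SimpleGraph.fromEdgeSet (H : Set (Sym2 V))).Reachable u v

namespace Network

variable {V : Type*} [Fintype V]

/-- The offline cost of the subgraph `H`: its edge cost plus the penalties of all requests whose
terminal is not connected to the root `r` in `H`. -/
def solutionCost (N : Network V) (r : V) (σ : List (Request V)) (H : Finset (Sym2 V)) : ℝ :=
  N.edgeCost H + (σ.map fun q => if ConnectedIn H q.vertex r then 0 else q.penalty).sum

/-- The offline optimum: the minimum cost of a subgraph. -/
def opt (N : Network V) (r : V) (σ : List (Request V)) : ℝ :=
  N.edges.powerset.inf' ⟨∅, by simp⟩ (N.solutionCost r σ)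

end Network

/-- A deterministic online algorithm: from the past requests (in order of arrival) and the current
request it computes an irrevocable decision, `none` to pay the current penalty, or `some F` to add
the edges `F` to the subgraph. -/
def OnlineAlgorithm (V : Type*) := List (Request V) → Request V → Option (Finset (Sym2 V))

namespace OnlineAlgorithm

variable {V : Type*} [Fintype V]

/-- The decision taken on the request number `t` of `σ`. -/
def decision (A : OnlineAlgorithm V) (σ : List (Request V)) (t : Fin σ.length) :
    Option (Finset (Sym2 V)) :=
  A (σ.take t) (σ.get t)

/-- The subgraph `H` bought while serving `σ`. -/
def bought (A : OnlineAlgorithm V) (σ : List (Request V)) : Finset (Sym2 V) :=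
  Finset.univ.biUnion fun t : Fin σ.length => (A.decision σ t).getD ∅

/-- The penalties paid while serving `σ`; a penalty that was paid is never refunded. -/
def penaltyPaid (A : OnlineAlgorithm V) (σ : List (Request V)) : ℝ :=
  ∑ t : Fin σ.length, if A.decision σ t = none then (σ.get t).penalty else 0

/-- The total cost of the algorithm on `σ`. -/
def cost (A : OnlineAlgorithm V) (N : Network V) (σ : List (Request V)) : ℝ :=
  N.edgeCost (A.bought σ) + A.penaltyPaid σ

/-- The algorithm solves online prize-collecting Steiner tree on `N` with root `r`: it only buys
edges of the graph, and each terminal whose penalty is not paid is connected to the root right after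
it has been served. -/
def Solves (A : OnlineAlgorithm V) (N : Network V) (r : V) : Prop :=
  ∀ σ : List (Request V), A.bought σ ⊆ N.edges ∧
    ∀ t : Fin σ.length, A.decision σ t ≠ none →
      ConnectedIn (A.bought (σ.take (t + 1))) (σ.get t).vertex r

end OnlineAlgorithm

/-- A served terminal with its class and its cost share. -/
structure Share (V : Type*) where
  vertex : V
  cls : ℤ
  share : ℝ

/-- The memory of the cost-share algorithm: the buy terminals other than the root, and the classified
terminals with their cost shares. -/
structure State (V : Type*) where
  buy : List V
  shares : List (Share V)

/-- The value at which a cost share stops that is raised from `0` until together with `s` it reaches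
`goal`, or until it is equal to `π`. -/
def raise (s goal π : ℝ) : ℝ := min π (max 0 (goal - s))

theorem raise_isLeast (s goal π : ℝ) (hπ : 0 ≤ π) :
    IsLeast {x : ℝ | 0 ≤ x ∧ (goal ≤ s + x ∨ x = π)} (raise s goal π) := by
  unfold raise
  refine ⟨⟨le_min hπ (le_max_left _ _), ?_⟩, ?_⟩
  · rcases le_total π (max 0 (goal - s)) with h | h
    · exact Or.inr (min_eq_left h)
    · left
      rw [min_eq_right h]
      linarith [le_max_right 0 (goal - s)]
  · rintro x ⟨hx0, h | h⟩
    · exact (min_le_right _ _).trans (max_le hx0 (by linarith))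
    · exact (min_le_left _ _).trans h.ge

section Algorithm

variable {V : Type*} [Fintype V]

/-- A closest vertex to `i` among the root `r` and the buy terminals in `Z`, ties being broken by
order of purchase. -/
def nearest (N : Network V) (r : V) (Z : List V) (i : V) : V :=
  ((r :: Z).argmin (fun z => N.dist i z)).getD r

/-- The total cost share of the terminals of class `j` at distance less than `2 ^ (j - 1)` from `i`
that arrived so far. -/
def witnessShare (N : Network V) (L : List (Share V)) (j : ℤ) (i : V) : ℝ :=
  ((L.filter fun x => x.cls = j ∧ N.dist i x.vertex < (2 : ℝ) ^ (j - 1)).map Share.share).sum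

/-- One step of the cost-share algorithm. A terminal at distance `0` from a buy terminal has no class
and is connected at no cost. Otherwise, `Int.log 2 a` is the `j` with `2 ^ j ≤ a < 2 ^ (j + 1)`. -/
def step (N : Network V) (r : V) (S : State V) (q : Request V) :
    State V × Option (Finset (Sym2 V)) :=
  let z := nearest N r S.buy q.vertex
  let a := N.dist q.vertex z
  if a = 0 then
    (⟨S.buy ++ [q.vertex], S.shares⟩, some (N.shortestPathEdges q.vertex z))
  else
    let j := Int.log 2 a
    let s := witnessShare N S.shares j q.vertex
    let ρ := raise s ((2 : ℝ) ^ (j + 1)) q.penalty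
    if (2 : ℝ) ^ (j + 1) ≤ s + ρ then
      (⟨S.buy ++ [q.vertex], S.shares ++ [⟨q.vertex, j, ρ⟩]⟩,
        some (N.shortestPathEdges q.vertex z))
    else
      (⟨S.buy, S.shares ++ [⟨q.vertex, j, ρ⟩]⟩, none)

/-- The cost-share algorithm for online prize-collecting Steiner tree. -/
def costShareAlgorithm (N : Network V) (r : V) : OnlineAlgorithm V := fun past q =>
  (step N r (past.foldl (fun S p => (step N r S p).1) ⟨[], []⟩) q).2

end Algorithm

/-- The set of terminals: the root and the terminals that arrive. -/
def terminals {V : Type*} (r : V) (σ : List (Request V)) : Finset V :=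
  insert r (σ.map Request.vertex).toFinset

/-- In the graph `T` rooted at `o`, `y` is a child of `x`. -/
def IsChild {M : Type*} (T : SimpleGraph M) (o x y : M) : Prop :=
  T.Adj x y ∧ T.dist o y = T.dist o x + 1

/-- An expanding embedding of the finite metric space `(X, d)` into a hierarchically separated tree
with node set `M`. -/
structure HSTEmbedding {V : Type*} (X : Finset V) (d : V → V → ℝ) (M : Type*) [Fintype M] where
  net : Network M
  isTree : net.graph.IsTree
  root : M
  /-- The node of the tree that represents a point of `X`. -/
  leaf : V → M
  /-- The leaves of the tree are exactly the points of `X`. -/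
  leaves : Set.BijOn leaf X {x | ∀ y, ¬ IsChild net.graph root x y}
  /-- The edge lengths are powers of two. -/
  length_pow : ∀ e ∈ net.graph.edgeSet, ∃ j : ℤ, net.weight e = (2 : ℝ) ^ j
  /-- Each node has the same distance to all of its children. -/
  length_siblings : ∀ x y y', IsChild net.graph root x y → IsChild net.graph root x y' →
    net.weight s(x, y) = net.weight s(x, y')
  /-- The edge lengths decrease by a factor of two along each path from the root to a leaf. -/
  length_halves : ∀ x y z, IsChild net.graph root x y → IsChild net.graph root y z →
    net.weight s(y, z) = net.weight s(x, y) / 2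
  /-- Points separated from the root by an edge of length `2 ^ (j - 1)` are at distance less than
  `2 ^ j` from each other. -/
  cut_diam : ∀ e ∈ net.graph.edgeSet, ∀ j : ℤ, net.weight e = (2 : ℝ) ^ (j - 1) →
    ∀ u ∈ X, ∀ v ∈ X, ¬ (net.graph.deleteEdges {e}).Reachable root (leaf u) →
      ¬ (net.graph.deleteEdges {e}).Reachable root (leaf v) → d u v < (2 : ℝ) ^ j
  /-- The embedding does not shrink distances. -/
  expanding : ∀ u ∈ X, ∀ v ∈ X, d u v ≤ net.dist (leaf u) (leaf v)

/-- `OPT(T)`: the offline optimum of the same instance on the tree. -/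
def HSTEmbedding.opt {V M : Type*} [Fintype M] {X : Finset V} {d : V → V → ℝ}
    (T : HSTEmbedding X d M) (r : V) (σ : List (Request V)) : ℝ :=
  T.net.opt (T.leaf r) (σ.map (Request.map T.leaf))

end PCST

end

noncomputable section

open scoped Classical

namespace PCST

/-! ### Shortest-path distance and edge cost -/

namespace Network

variable {V : Type*} [Fintype V]

/-! The cost shares mediate between the algorithm and every offline solution.

The algorithm costs at most twice the total share. A paid penalty equals its own share. A purchase
of class `j` costs less than `2 ^ (j + 1)`, which its witnesses' shares cover, and no share is used
twice: a class `j` witness within `2 ^ (j - 1)` of both the new terminal and an earlier buy terminal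
would put these two at distance less than `2 ^ j`, although the nearest buy terminal is at least
that far (`edgeCost_bought_le`, `cost_le_shareSum`).

Conversely, fix an offline edge set `H`. Terminals that `H` leaves unconnected have shares bounded
by the penalties `H` pays. For connected ones two facts matter: a class `j` terminal is at distance
at least `2 ^ j` from the root, and a set of diameter less than `2 ^ (j - 1)` carries class `j`
share at most `2 ^ (j + 1)` (`shareSum_class_le`).

In an HST, each connected terminal of class `j` is charged to an edge of length at least `2 ^ (j -
2)` that `H` must contain and that cuts off a set of diameter less than `2 ^ (j - 1)`
(`exists_cut`). An edge then receives a geometric sum over classes, proportional to its length.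

In the graph, the logarithmic bound is proved directly, without a tree embedding. By ball packing,
every single class has connected share `O(c(H))` (`shareSum_class_connected_le`). Classes above
`log₂ c(H)` are empty, those more than about `log₂ k` below it are negligible even when summed over
all `k` terminals, and only about `log₂ k` classes remain. -/

theorem dist_le_walkLength (N : Network V) {u v : V} (p : N.graph.Walk u v) :
    N.dist u v ≤ N.walkLength p :=
  ciInf_le ⟨0, by rintro _ ⟨q, rfl⟩; exact N.walkLength_nonneg q⟩ p

theorem dist_nonneg (N : Network V) (u v : V) : 0 ≤ N.dist u v := by
  obtain ⟨p, -, hp⟩ := N.exists_shortestPath u v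
  exact hp ▸ N.walkLength_nonneg p

theorem dist_self (N : Network V) (u : V) : N.dist u u = 0 :=
  le_antisymm (by simpa [walkLength] using N.dist_le_walkLength (.nil : N.graph.Walk u u))
    (N.dist_nonneg u u)

theorem dist_comm (N : Network V) (u v : V) : N.dist u v = N.dist v u := by
  have key : ∀ a b, N.dist a b ≤ N.dist b a := by
    intro a b
    obtain ⟨p, -, hp⟩ := N.exists_shortestPath b a
    have := N.dist_le_walkLength p.reverse
    rw [← hp]
    simpa [walkLength, SimpleGraph.Walk.edges_reverse] using this
  exact le_antisymm (key u v) (key v u)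

theorem dist_triangle (N : Network V) (u v w : V) : N.dist u w ≤ N.dist u v + N.dist v w := by
  obtain ⟨p, -, hp⟩ := N.exists_shortestPath u v
  obtain ⟨q, -, hq⟩ := N.exists_shortestPath v w
  rw [← hp, ← hq]
  simpa [walkLength, SimpleGraph.Walk.edges_append] using N.dist_le_walkLength (p.append q)

theorem dist_le_weight (N : Network V) {u v : V} (h : N.graph.Adj u v) :
    N.dist u v ≤ N.weight s(u, v) := by
  simpa [walkLength] using N.dist_le_walkLength h.toWalk

theorem edgeCost_nonneg (N : Network V) (H : Finset (Sym2 V)) : 0 ≤ N.edgeCost H :=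
  Finset.sum_nonneg fun e _ => N.weight_nonneg e

theorem edgeCost_union_le (N : Network V) (H K : Finset (Sym2 V)) :
    N.edgeCost (H ∪ K) ≤ N.edgeCost H + N.edgeCost K := by
  have := Finset.sum_union_inter (s₁ := H) (s₂ := K) (f := N.weight)
  have h := N.edgeCost_nonneg (H ∩ K)
  unfold edgeCost at *
  linarith

theorem edgeCost_shortestPathEdges_le (N : Network V) (u v : V) :
    N.edgeCost (N.shortestPathEdges u v) ≤ N.dist u v := by
  obtain ⟨hp, hl⟩ := (N.exists_shortestPath u v).choose_spec
  exact ((List.sum_toFinset _ hp.isTrail.edges_nodup).trans hl).le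

theorem shortestPathEdges_subset (N : Network V) (u v : V) :
    N.shortestPathEdges u v ⊆ N.edges := by
  intro e he
  have : e ∈ (N.exists_shortestPath u v).choose.edges := by simpa [shortestPathEdges] using he
  simpa [edges] using SimpleGraph.Walk.edges_subset_edgeSet _ this

theorem connectedIn_shortestPathEdges (N : Network V) (u v : V) :
    ConnectedIn (N.shortestPathEdges u v) u v := by
  refine ⟨(N.exists_shortestPath u v).choose.transfer _ fun e he => ?_⟩
  rw [SimpleGraph.edgeSet_fromEdgeSet]
  refine ⟨by simpa [shortestPathEdges] using he, ?_⟩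
  exact N.graph.not_isDiag_of_mem_edgeSet (SimpleGraph.Walk.edges_subset_edgeSet _ he)

end Network

theorem ConnectedIn.mono {V : Type*} {H K : Finset (Sym2 V)} (h : H ⊆ K) {u v : V}
    (hc : ConnectedIn H u v) : ConnectedIn K u v :=
  SimpleGraph.Reachable.mono (SimpleGraph.fromEdgeSet_mono (by exact_mod_cast h)) hc

theorem ConnectedIn.trans {V : Type*} {H : Finset (Sym2 V)} {u v w : V}
    (h : ConnectedIn H u v) (h' : ConnectedIn H v w) : ConnectedIn H u w :=
  SimpleGraph.Reachable.trans h h'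

/-! ### Cost of an online algorithm when one request is appended -/

namespace OnlineAlgorithm

variable {V : Type*} (A : OnlineAlgorithm V)

theorem decision_append_left (σ τ : List (Request V)) (t : ℕ) (ht : t < σ.length)
    (ht' : t < (σ ++ τ).length) : A.decision (σ ++ τ) ⟨t, ht'⟩ = A.decision σ ⟨t, ht⟩ := by
  simp [decision, List.take_append_of_le_length ht.le, List.getElem_append_left ht]

theorem decision_append_last (σ : List (Request V)) (q : Request V)
    (ht : σ.length < (σ ++ [q]).length) : A.decision (σ ++ [q]) ⟨σ.length, ht⟩ = A σ q := by
  simp [decision]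

theorem bought_append (σ : List (Request V)) (q : Request V) :
    A.bought (σ ++ [q]) = A.bought σ ∪ (A σ q).getD ∅ := by
  ext e
  simp only [bought, Finset.mem_biUnion, Finset.mem_univ, true_and, Finset.mem_union]
  constructor
  · rintro ⟨⟨t, ht⟩, he⟩
    rcases lt_or_eq_of_le (Nat.lt_succ_iff.1 (by simpa using ht : t < σ.length + 1)) with h | rfl
    · exact Or.inl ⟨⟨t, h⟩, by rwa [A.decision_append_left σ [q] t h ht] at he⟩
    · exact Or.inr (by rwa [A.decision_append_last σ q ht] at he)
  · rintro (⟨⟨t, ht⟩, he⟩ | he)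
    · have ht' : t < (σ ++ [q]).length := by simp; omega
      exact ⟨⟨t, ht'⟩, by rwa [A.decision_append_left σ [q] t ht ht']⟩
    · have ht' : σ.length < (σ ++ [q]).length := by simp
      exact ⟨⟨_, ht'⟩, by rwa [A.decision_append_last σ q ht']⟩

theorem penaltyPaid_append (σ : List (Request V)) (q : Request V) :
    A.penaltyPaid (σ ++ [q]) = A.penaltyPaid σ + if A σ q = none then q.penalty else 0 := by
  have hl : σ.length + 1 = (σ ++ [q]).length := by simp
  unfold penaltyPaid
  rw [← Equiv.sum_comp (finCongr hl), Fin.sum_univ_castSucc]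
  congr 1
  · refine Finset.sum_congr rfl fun t _ => ?_
    have h1 : A.decision (σ ++ [q]) (finCongr hl t.castSucc) = A.decision σ t :=
      A.decision_append_left σ [q] t t.2 _
    have h2 : (σ ++ [q]).get (finCongr hl t.castSucc) = σ.get t := by
      simp [List.getElem_append_left t.2]
    rw [h1, h2]
  · have h1 : A.decision (σ ++ [q]) (finCongr hl (Fin.last _)) = A σ q :=
      A.decision_append_last σ q _
    have h2 : (σ ++ [q]).get (finCongr hl (Fin.last _)) = q := by simp
    rw [h1, h2]

theorem bought_nil : A.bought [] = ∅ := by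
  ext e; simp [bought]

theorem penaltyPaid_nil : A.penaltyPaid [] = 0 := by
  simp [penaltyPaid]

end OnlineAlgorithm

/-! ### Sums of cost shares over predicates -/

/-- The total cost share of the entries of `L` that satisfy `P`. -/
def shareSum {V : Type*} (L : List (Share V)) (P : Share V → Prop) : ℝ :=
  (L.map fun x => if P x then x.share else 0).sum

section ShareSum

variable {V : Type*}

theorem shareSum_append (L K : List (Share V)) (P : Share V → Prop) :
    shareSum (L ++ K) P = shareSum L P + shareSum K P := by
  simp [shareSum]

theorem shareSum_singleton (x : Share V) (P : Share V → Prop) :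
    shareSum [x] P = if P x then x.share else 0 := by
  simp [shareSum]

theorem shareSum_nonneg {L : List (Share V)} (hL : ∀ x ∈ L, 0 ≤ x.share) (P : Share V → Prop) :
    0 ≤ shareSum L P := by
  apply List.sum_nonneg
  intro y hy
  obtain ⟨x, hx, rfl⟩ := List.mem_map.1 hy
  split_ifs
  exacts [hL x hx, le_rfl]

/-- If each entry that satisfies `P` satisfies one of the `Q e`, then the total share of `P` is at
most the sum of the total shares of the `Q e`. -/
theorem shareSum_le_sum {ι : Type*} {L : List (Share V)} (hL : ∀ x ∈ L, 0 ≤ x.share)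
    {P : Share V → Prop} (E : Finset ι) (Q : ι → Share V → Prop)
    (h : ∀ x ∈ L, P x → ∃ e ∈ E, Q e x) :
    shareSum L P ≤ ∑ e ∈ E, shareSum L (Q e) := by
  induction L with
  | nil => simp [shareSum]
  | cons x L ih =>
    have ih := ih (fun y hy => hL y (by simp [hy])) fun y hy => h y (by simp [hy])
    have hx : (if P x then x.share else 0) ≤ ∑ e ∈ E, if Q e x then x.share else 0 := by
      have h0 : ∀ e ∈ E, 0 ≤ if Q e x then x.share else 0 := fun e _ => by
        split_ifs
        exacts [hL x (by simp), le_rfl]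
      split_ifs with hP
      · obtain ⟨e, he, hQ⟩ := h x (by simp) hP
        exact (by simp [hQ] : x.share ≤ if Q e x then x.share else 0).trans
          (Finset.single_le_sum h0 he)
      · exact Finset.sum_nonneg h0
    simp only [shareSum, List.map_cons, List.sum_cons, Finset.sum_add_distrib] at ih ⊢
    exact add_le_add hx ih

theorem shareSum_mono {L : List (Share V)} (hL : ∀ x ∈ L, 0 ≤ x.share) {P Q : Share V → Prop}
    (h : ∀ x ∈ L, P x → Q x) : shareSum L P ≤ shareSum L Q := by
  simpa using shareSum_le_sum hL {()} (fun _ => Q) (fun x hx hP => ⟨(), by simp, h x hx hP⟩)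

theorem shareSum_or_le {L : List (Share V)} (hL : ∀ x ∈ L, 0 ≤ x.share) {P Q R : Share V → Prop}
    (h : ∀ x ∈ L, P x → Q x ∨ R x) : shareSum L P ≤ shareSum L Q + shareSum L R := by
  have := shareSum_le_sum hL Finset.univ (fun b : Bool => if b then Q else R) (P := P)
    (fun x hx hP => (h x hx hP).elim (fun h => ⟨true, by simp [h]⟩) fun h => ⟨false, by simp [h]⟩)
  simpa using this

theorem shareSum_add_le {L : List (Share V)} (hL : ∀ x ∈ L, 0 ≤ x.share) {P Q R : Share V → Prop}
    (hP : ∀ x ∈ L, P x → R x ∧ ¬ Q x) (hQ : ∀ x ∈ L, Q x → R x) :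
    shareSum L P + shareSum L Q ≤ shareSum L R := by
  unfold shareSum
  rw [← List.sum_map_add]
  apply List.sum_le_sum
  intro x hx
  have := hP x hx
  have := hQ x hx
  have := hL x hx
  split_ifs <;> first | linarith | tauto

theorem shareSum_eq_zero {L : List (Share V)} {P : Share V → Prop} (h : ∀ x ∈ L, ¬ P x) :
    shareSum L P = 0 := by
  apply List.sum_eq_zero
  intro y hy
  obtain ⟨x, hx, rfl⟩ := List.mem_map.1 hy
  simp [h x hx]

theorem witnessShare_eq [Fintype V] (N : Network V) (L : List (Share V)) (j : ℤ) (i : V) :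
    witnessShare N L j i
      = shareSum L fun x => x.cls = j ∧ N.dist i x.vertex < (2 : ℝ) ^ (j - 1) := by
  unfold witnessShare shareSum
  induction L with
  | nil => simp
  | cons x L ih =>
    rw [List.filter_cons]
    by_cases h : x.cls = j ∧ N.dist i x.vertex < (2 : ℝ) ^ (j - 1)
    · simp only [h, and_self, decide_true, if_true, List.map_cons, List.sum_cons]
      simp only [ih]
    · simp only [h, decide_false, if_false, List.map_cons, List.sum_cons, zero_add]
      simpa using ih

end ShareSum

/-! ### Invariants of the algorithm; its cost against the total share -/

section Run

variable {V : Type*} [Fintype V] (N : Network V) (r : V)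

theorem nearest_spec (Z : List V) (i : V) :
    nearest N r Z i ∈ r :: Z ∧ ∀ z ∈ r :: Z, N.dist i (nearest N r Z i) ≤ N.dist i z := by
  obtain ⟨m, hm⟩ : ∃ m, (r :: Z).argmin (fun z => N.dist i z) = some m :=
    Option.ne_none_iff_exists'.1 fun h => by simpa using List.argmin_eq_none.1 h
  have h : nearest N r Z i = m := by simp [nearest, hm]
  rw [h]
  exact ⟨List.argmin_mem hm, fun z hz => List.le_of_mem_argmin hz hm⟩

/-- What a step of the algorithm does: connect at no cost, or connect because the witnesses are rich
enough, or pay the penalty. -/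
theorem step_cases (S : State V) (q : Request V) :
    ∃ z ∈ r :: S.buy, (∀ z' ∈ r :: S.buy, N.dist q.vertex z ≤ N.dist q.vertex z') ∧
      ((N.dist q.vertex z = 0 ∧ step N r S q =
          (⟨S.buy ++ [q.vertex], S.shares⟩, some (N.shortestPathEdges q.vertex z))) ∨
        ∃ (j : ℤ) (s ρ : ℝ), 0 ≤ ρ ∧ ρ ≤ q.penalty ∧ (2 : ℝ) ^ j ≤ N.dist q.vertex z ∧
          N.dist q.vertex z < (2 : ℝ) ^ (j + 1) ∧
          s = shareSum S.shares
            (fun x => x.cls = j ∧ N.dist q.vertex x.vertex < (2 : ℝ) ^ (j - 1)) ∧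
          (ρ = 0 ∨ s + ρ ≤ (2 : ℝ) ^ (j + 1)) ∧
          (((2 : ℝ) ^ (j + 1) ≤ s + ρ ∧ step N r S q =
              (⟨S.buy ++ [q.vertex], S.shares ++ [⟨q.vertex, j, ρ⟩]⟩,
                some (N.shortestPathEdges q.vertex z))) ∨
            (ρ = q.penalty ∧ step N r S q =
              (⟨S.buy, S.shares ++ [⟨q.vertex, j, ρ⟩]⟩, none)))) := by
  obtain ⟨hz, hmin⟩ := nearest_spec N r S.buy q.vertex
  refine ⟨_, hz, hmin, ?_⟩
  unfold step
  generalize nearest N r S.buy q.vertex = z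
  by_cases ha : N.dist q.vertex z = 0
  · exact Or.inl ⟨ha, by simp [ha]⟩
  right
  have hpos : 0 < N.dist q.vertex z := lt_of_le_of_ne (N.dist_nonneg _ _) (Ne.symm ha)
  simp only [ha, if_false, witnessShare_eq]
  generalize hj : Int.log 2 (N.dist q.vertex z) = j
  generalize hs : shareSum S.shares
    (fun x => x.cls = j ∧ N.dist q.vertex x.vertex < (2 : ℝ) ^ (j - 1)) = s
  have h1 := Int.zpow_log_le_self (b := 2) (by norm_num) hpos
  have h2 := Int.lt_zpow_succ_log_self (b := 2) (by norm_num) (N.dist q.vertex z)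
  rw [hj] at h1 h2
  have hl := (raise_isLeast s ((2 : ℝ) ^ (j + 1)) q.penalty q.penalty_nonneg).1
  have hπ : raise s ((2 : ℝ) ^ (j + 1)) q.penalty ≤ q.penalty := min_le_left _ _
  have hcap : raise s ((2 : ℝ) ^ (j + 1)) q.penalty ≤ max 0 ((2 : ℝ) ^ (j + 1) - s) :=
    min_le_right _ _
  revert hl hπ hcap
  generalize raise s ((2 : ℝ) ^ (j + 1)) q.penalty = ρ
  rintro ⟨hρ, hor⟩ hπ hcap
  refine ⟨j, s, ρ, hρ, hπ, by exact_mod_cast h1, by exact_mod_cast h2, hs.symm, ?_, ?_⟩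
  -- The witness ball may have diameter larger than its radius, so `s` alone can already exceed the
  -- goal; then nothing is raised. Otherwise raising stops at the goal.
  · rcases le_max_iff.1 hcap with h | h
    · exact Or.inl (le_antisymm h hρ)
    · exact Or.inr (by linarith)
  · by_cases hg : (2 : ℝ) ^ (j + 1) ≤ s + ρ
    · exact Or.inl ⟨hg, by simp [hg]⟩
    · exact Or.inr ⟨hor.resolve_left hg, by simp [hg]⟩

/-- The memory of the algorithm after it has served `σ`. -/
def run (σ : List (Request V)) : State V :=
  σ.foldl (fun S p => (step N r S p).1) ⟨[], []⟩

theorem run_nil : run N r [] = ⟨[], []⟩ := rfl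

theorem run_append (σ : List (Request V)) (q : Request V) :
    run N r (σ ++ [q]) = (step N r (run N r σ) q).1 := by
  simp [run]

theorem costShareAlgorithm_apply (σ : List (Request V)) (q : Request V) :
    costShareAlgorithm N r σ q = (step N r (run N r σ) q).2 := rfl

/-- The lower bound on the distance to `r` holds because the root is always among the candidates for
the nearest buy terminal. It is what forces an offline solution to spend on connecting an entry. -/
theorem shares_run_spec (σ : List (Request V)) :
    ∀ x ∈ (run N r σ).shares, 0 ≤ x.share ∧ x.vertex ∈ σ.map Request.vertex ∧
      (2 : ℝ) ^ x.cls ≤ N.dist x.vertex r := by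
  induction σ using List.reverseRecOn with
  | nil => simp [run_nil]
  | append_singleton σ q ih =>
    have ih' : ∀ x ∈ (run N r σ).shares, 0 ≤ x.share ∧
        x.vertex ∈ (σ ++ [q]).map Request.vertex ∧ (2 : ℝ) ^ x.cls ≤ N.dist x.vertex r := by
      intro x hx
      obtain ⟨h1, h2, h3⟩ := ih x hx
      exact ⟨h1, by simp at h2 ⊢; exact Or.inl h2, h3⟩
    rw [run_append]
    obtain ⟨z, hz, hmin, ⟨-, hS⟩ | ⟨j, s, ρ, hρ, -, hj, -, -, -, ⟨-, hS⟩ | ⟨-, hS⟩⟩⟩ :=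
      step_cases N r (run N r σ) q
    · rw [hS]; exact ih'
    all_goals
      rw [hS]
      intro x hx
      rcases List.mem_append.1 hx with hx | hx
      · exact ih' x hx
      · obtain rfl := List.mem_singleton.1 hx
        exact ⟨hρ, by simp, hj.trans (hmin r (by simp))⟩

theorem share_nonneg {σ : List (Request V)} : ∀ x ∈ (run N r σ).shares, 0 ≤ x.share :=
  fun x hx => (shares_run_spec N r σ x hx).1

/-- The cost shares are at most the penalties. -/
theorem shareSum_le_penalties (σ : List (Request V)) (P : V → Prop) :
    shareSum (run N r σ).shares (fun x => P x.vertex)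
      ≤ (σ.map fun q => if P q.vertex then q.penalty else 0).sum := by
  induction σ using List.reverseRecOn with
  | nil => simp [run_nil, shareSum]
  | append_singleton σ q ih =>
    rw [run_append, List.map_append, List.sum_append]
    have hq : 0 ≤ if P q.vertex then q.penalty else 0 := by
      split_ifs
      exacts [q.penalty_nonneg, le_rfl]
    obtain ⟨z, hz, hmin, ⟨-, hS⟩ | ⟨j, s, ρ, hρ, hπ, hj, -, -, -, ⟨-, hS⟩ | ⟨-, hS⟩⟩⟩ :=
      step_cases N r (run N r σ) q
    · rw [hS]; simpa using add_le_add ih hq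
    all_goals
      rw [hS]
      simp only [shareSum_append, shareSum_singleton, List.map_cons, List.map_nil, List.sum_cons,
        List.sum_nil, add_zero]
      refine add_le_add ih ?_
      split_ifs
      exacts [hπ, le_rfl]

/-- The total share of class `j` of a set of small diameter is bounded. -/
theorem shareSum_class_le (σ : List (Request V)) (j : ℤ) (A : V → Prop)
    (hA : ∀ u v, A u → A v → N.dist u v < (2 : ℝ) ^ (j - 1)) :
    shareSum (run N r σ).shares (fun x => x.cls = j ∧ A x.vertex) ≤ (2 : ℝ) ^ (j + 1) := by
  induction σ using List.reverseRecOn with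
  | nil => simp [run_nil, shareSum]; positivity
  | append_singleton σ q ih =>
    rw [run_append]
    obtain ⟨z, hz, hmin, ⟨-, hS⟩ | ⟨i, s, ρ, hρ, hπ, hj, -, hs, hc, ⟨-, hS⟩ | ⟨-, hS⟩⟩⟩ :=
      step_cases N r (run N r σ) q
    · rw [hS]; exact ih
    all_goals
      rw [hS]
      simp only [shareSum_append, shareSum_singleton]
      split_ifs with h
      · obtain ⟨rfl, hq⟩ := h
        rcases hc with rfl | hc
        · simpa using ih
        · have := shareSum_mono (share_nonneg N r (σ := σ))
            (P := fun x => x.cls = i ∧ A x.vertex)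
            (Q := fun x => x.cls = i ∧ N.dist q.vertex x.vertex < (2 : ℝ) ^ (i - 1))
            (fun x _ hx => ⟨hx.1, hA _ _ hq hx.2⟩)
          linarith
      · simpa using ih

/-- The edges bought are paid for by the witnesses of the buy terminals. -/
theorem edgeCost_bought_le (σ : List (Request V)) :
    N.edgeCost ((costShareAlgorithm N r).bought σ) ≤ shareSum (run N r σ).shares
      (fun x => ∃ z ∈ (run N r σ).buy, N.dist z x.vertex < (2 : ℝ) ^ (x.cls - 1)) := by
  induction σ using List.reverseRecOn with
  | nil => simp [run_nil, shareSum, OnlineAlgorithm.bought_nil, Network.edgeCost]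
  | append_singleton σ q ih =>
    rw [run_append, OnlineAlgorithm.bought_append, costShareAlgorithm_apply]
    have hnn := share_nonneg N r (σ := σ)
    obtain ⟨z, hz, hmin, ⟨hd, hS⟩ | ⟨j, s, ρ, hρ, hπ, hj, hj', hs, hc, ⟨hb, hS⟩ | ⟨-, hS⟩⟩⟩ :=
      step_cases N r (run N r σ) q
    · rw [hS]
      refine (N.edgeCost_union_le _ _).trans ?_
      have h1 := N.edgeCost_shortestPathEdges_le q.vertex z
      have h2 := shareSum_mono hnn
        (P := fun x => ∃ z ∈ (run N r σ).buy, N.dist z x.vertex < (2 : ℝ) ^ (x.cls - 1))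
        (Q := fun x => ∃ z ∈ (run N r σ).buy ++ [q.vertex],
          N.dist z x.vertex < (2 : ℝ) ^ (x.cls - 1))
        (fun x _ ⟨z, hz, h⟩ => ⟨z, List.mem_append_left _ hz, h⟩)
      simp only [Option.getD_some]
      linarith
    · rw [hS]
      refine (N.edgeCost_union_le _ _).trans ?_
      have h1 := N.edgeCost_shortestPathEdges_le q.vertex z
      have h2 := shareSum_add_le hnn
        (Q := fun x => ∃ z ∈ (run N r σ).buy, N.dist z x.vertex < (2 : ℝ) ^ (x.cls - 1))
        (P := fun x => x.cls = j ∧ N.dist q.vertex x.vertex < (2 : ℝ) ^ (j - 1))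
        (R := fun x => ∃ z ∈ (run N r σ).buy ++ [q.vertex],
          N.dist z x.vertex < (2 : ℝ) ^ (x.cls - 1))
        (by
          rintro x - ⟨rfl, hx⟩
          refine ⟨⟨q.vertex, by simp, hx⟩, ?_⟩
          -- Disjointness of witness sets: an entry already claimed by `y` would give a buy terminal
          -- at distance less than `2 ^ x.cls` from `q`, closer than the nearest one.
          rintro ⟨y, hy, hyx⟩
          have h1 := hmin y (List.mem_cons_of_mem _ hy)
          have h2 := N.dist_triangle q.vertex x.vertex y
          rw [N.dist_comm x.vertex y] at h2
          have h3 : (2 : ℝ) ^ x.cls = 2 * (2 : ℝ) ^ (x.cls - 1) := by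
            rw [← zpow_one_add₀ two_ne_zero]; congr 1; ring
          linarith)
        (fun x _ ⟨z, hz, h⟩ => ⟨z, List.mem_append_left _ hz, h⟩)
      -- The new share also counts as claimed, by the new buy terminal itself, so all of `s + ρ` is
      -- available for the path.
      have h3 : ∃ z ∈ (run N r σ).buy ++ [q.vertex], N.dist z q.vertex < (2 : ℝ) ^ (j - 1) :=
        ⟨q.vertex, by simp, by rw [N.dist_self]; positivity⟩
      simp only [Option.getD_some, shareSum_append, shareSum_singleton, if_pos h3]
      linarith
    · rw [hS]
      have h : 0 ≤ shareSum [⟨q.vertex, j, ρ⟩] (fun x => ∃ z ∈ (run N r σ).buy,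
          N.dist z x.vertex < (2 : ℝ) ^ (x.cls - 1)) :=
        shareSum_nonneg (by simpa using hρ) _
      simp only [Option.getD_none, Finset.union_empty, shareSum_append]
      linarith

/-- The penalties paid are covered by the cost shares. -/
theorem penaltyPaid_le (σ : List (Request V)) :
    (costShareAlgorithm N r).penaltyPaid σ ≤ shareSum (run N r σ).shares (fun _ => True) := by
  induction σ using List.reverseRecOn with
  | nil => simp [run_nil, shareSum, OnlineAlgorithm.penaltyPaid_nil]
  | append_singleton σ q ih =>
    rw [run_append, OnlineAlgorithm.penaltyPaid_append, costShareAlgorithm_apply]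
    obtain ⟨z, hz, hmin, ⟨hd, hS⟩ | ⟨j, s, ρ, hρ, hπ, hj, hj', hs, hc, ⟨hb, hS⟩ | ⟨hp, hS⟩⟩⟩ :=
      step_cases N r (run N r σ) q
    · rw [hS]; simpa using ih
    all_goals
      rw [hS]
      simp only [shareSum_append, shareSum_singleton, if_true, reduceCtorEq, if_false]
      linarith

theorem cost_le_shareSum (σ : List (Request V)) :
    (costShareAlgorithm N r).cost N σ ≤ 2 * shareSum (run N r σ).shares (fun _ => True) := by
  have h1 := edgeCost_bought_le N r σ
  have h2 := penaltyPaid_le N r σ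
  have h3 := shareSum_mono (share_nonneg N r (σ := σ))
    (P := fun x => ∃ z ∈ (run N r σ).buy, N.dist z x.vertex < (2 : ℝ) ^ (x.cls - 1))
    (Q := fun _ => True) (fun _ _ _ => trivial)
  unfold OnlineAlgorithm.cost
  linarith

/-- The part of the cost shares that an offline solution does not pay for by penalties. -/
theorem shareSum_le_connected (σ : List (Request V)) (P : V → Prop) :
    shareSum (run N r σ).shares (fun _ => True)
      ≤ shareSum (run N r σ).shares (fun x => P x.vertex)
        + (σ.map fun q => if P q.vertex then 0 else q.penalty).sum := by
  have h1 : _ ≤ (σ.map fun q => if P q.vertex then 0 else q.penalty).sum :=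
    (shareSum_le_penalties N r σ (fun v => ¬ P v)).trans_eq <| congrArg List.sum <|
      List.map_congr_left fun q _ => by by_cases h : P q.vertex <;> simp [h]
  have h2 := shareSum_or_le (share_nonneg N r (σ := σ)) (P := fun _ => True)
    (Q := fun x => P x.vertex) (R := fun x => ¬ P x.vertex) (fun x _ _ => em _)
  linarith

theorem bought_subset_edges (σ : List (Request V)) :
    (costShareAlgorithm N r).bought σ ⊆ N.edges := by
  induction σ using List.reverseRecOn with
  | nil => simp [OnlineAlgorithm.bought_nil]
  | append_singleton σ q ih =>
    rw [OnlineAlgorithm.bought_append, costShareAlgorithm_apply]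
    refine Finset.union_subset ih ?_
    obtain ⟨z, hz, hmin, ⟨hd, hS⟩ | ⟨j, s, ρ, -, -, -, -, -, -, ⟨hb, hS⟩ | ⟨hp, hS⟩⟩⟩ :=
      step_cases N r (run N r σ) q
    · rw [hS]; exact N.shortestPathEdges_subset _ _
    · rw [hS]; exact N.shortestPathEdges_subset _ _
    · rw [hS]; simp

theorem connectedIn_of_mem_buy (σ : List (Request V)) :
    ∀ z ∈ r :: (run N r σ).buy, ConnectedIn ((costShareAlgorithm N r).bought σ) z r := by
  induction σ using List.reverseRecOn with
  | nil => simp [run_nil, ConnectedIn]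
  | append_singleton σ q ih =>
    rw [run_append, OnlineAlgorithm.bought_append, costShareAlgorithm_apply]
    have ih' := fun F z hz => (ih z hz).mono (Finset.subset_union_left (s₂ := F))
    have hnew : ∀ z ∈ r :: (run N r σ).buy, ConnectedIn ((costShareAlgorithm N r).bought σ ∪
        N.shortestPathEdges q.vertex z) q.vertex r := fun z hz =>
      ((N.connectedIn_shortestPathEdges _ _).mono Finset.subset_union_right).trans (ih' _ z hz)
    obtain ⟨z, hz, hmin, ⟨hd, hS⟩ | ⟨j, s, ρ, -, -, -, -, -, -, ⟨hb, hS⟩ | ⟨hp, hS⟩⟩⟩ :=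
      step_cases N r (run N r σ) q
    · rw [hS]
      intro y hy
      rw [← List.cons_append] at hy
      rcases List.mem_append.1 hy with hy | hy
      · exact ih' _ y hy
      · rw [List.mem_singleton.1 hy]; exact hnew z hz
    · rw [hS]
      intro y hy
      rw [← List.cons_append] at hy
      rcases List.mem_append.1 hy with hy | hy
      · exact ih' _ y hy
      · rw [List.mem_singleton.1 hy]; exact hnew z hz
    · rw [hS]; exact ih' _

theorem costShareAlgorithm_solves : (costShareAlgorithm N r).Solves N r := by
  refine fun σ => ⟨bought_subset_edges N r σ, fun t ht => ?_⟩
  have hσ : σ.take (t + 1) = σ.take t ++ [σ.get t] := by simp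
  have hbuy : (σ.get t).vertex ∈ (run N r (σ.take (t + 1))).buy := by
    rw [hσ, run_append]
    have ht' : (step N r (run N r (σ.take t)) (σ.get t)).2 ≠ none := ht
    obtain ⟨z, hz, hmin, ⟨hd, hS⟩ | ⟨j, s, ρ, -, -, -, -, -, -, ⟨hb, hS⟩ | ⟨hp, hS⟩⟩⟩ :=
      step_cases N r (run N r (σ.take t)) (σ.get t)
    · rw [hS]; simp
    · rw [hS]; simp
    · exact absurd (by rw [hS]) ht'
  exact connectedIn_of_mem_buy N r _ _ (List.mem_cons_of_mem _ hbuy)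

end Run

/-! ### Edges separating a vertex from the root of a tree -/

section RootedTree

variable {M : Type*} {T : SimpleGraph M} {o : M}

theorem exists_parent (hT : T.Connected) {v : M} (hv : v ≠ o) : ∃ u, IsChild T o u v := by
  obtain ⟨p, hp⟩ := hT.exists_walk_length_eq_dist v o
  cases p with
  | nil => exact absurd rfl hv
  | @cons _ u _ h p =>
    refine ⟨u, h.symm, ?_⟩
    have h1 := SimpleGraph.dist_le p
    have h2 := hT.dist_triangle (u := o) (v := u) (w := v)
    have h3 := SimpleGraph.dist_eq_one_iff_adj.2 h.symm
    rw [SimpleGraph.Walk.length_cons, SimpleGraph.dist_comm] at hp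
    rw [SimpleGraph.dist_comm] at h1
    omega

theorem IsChild.adj_deleteEdges {x y u v : M} (h : IsChild T o u v) (hv : v ≠ y ∨ u ≠ x)
    (hxy : IsChild T o x y) : (T.deleteEdges {s(x, y)}).Adj u v := by
  rw [SimpleGraph.deleteEdges_adj]
  refine ⟨h.1, fun he => ?_⟩
  rcases Sym2.eq_iff.1 he with ⟨rfl, rfl⟩ | ⟨rfl, rfl⟩
  · simp at hv
  · have := h.2
    have := hxy.2
    omega

/-- Climbing from `v` to the root through parents never visits `y`, which is deeper than `v`. -/
theorem reachable_of_dist_le (hT : T.Connected) {x y : M} (hxy : IsChild T o x y) (v : M)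
    (hv : T.dist o v ≤ T.dist o x) : (T.deleteEdges {s(x, y)}).Reachable o v := by
  induction h : T.dist o v generalizing v with
  | zero => rw [hT.dist_eq_zero_iff.1 h]
  | succ n ih =>
    obtain ⟨u, hu⟩ := exists_parent hT (o := o) (v := v) (by rintro rfl; simp at h)
    have h2 := hu.2
    refine (ih u (by omega) (by omega)).trans (hu.adj_deleteEdges (Or.inl ?_) hxy).reachable
    rintro rfl
    have := hxy.2
    omega

theorem not_reachable_child (hT : T.IsTree) {x y : M} (hxy : IsChild T o x y) :
    ¬ (T.deleteEdges {s(x, y)}).Reachable o y := fun h =>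
  SimpleGraph.isAcyclic_iff_forall_adj_isBridge.1 hT.isAcyclic hxy.1
    ((reachable_of_dist_le hT.connected hxy x le_rfl).symm.trans h)

/-- A childless `y` is nobody's parent, so the climb from another vertex to the root avoids it. Thus
a leaf edge cuts off its leaf only. -/
theorem reachable_of_ne_leaf (hT : T.Connected) {x y : M} (hxy : IsChild T o x y)
    (hy : ∀ z, ¬ IsChild T o y z) (v : M) (hv : v ≠ y) :
    (T.deleteEdges {s(x, y)}).Reachable o v := by
  induction h : T.dist o v generalizing v with
  | zero => rw [hT.dist_eq_zero_iff.1 h]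
  | succ n ih =>
    obtain ⟨u, hu⟩ := exists_parent hT (o := o) (v := v) (by rintro rfl; simp at h)
    have h2 := hu.2
    exact (ih u (by rintro rfl; exact hy _ hu) (by omega)).trans
      (hu.adj_deleteEdges (Or.inl hv) hxy).reachable

/-- On each level above `v` there is an edge that separates `v` from the root. -/
theorem exists_separating_edge (hT : T.IsTree) (m : ℕ) (v : M) (hm : m < T.dist o v) :
    ∃ x y, IsChild T o x y ∧ T.dist o x = m ∧ ¬ (T.deleteEdges {s(x, y)}).Reachable o v ∧
      (m + 1 = T.dist o v → y = v) := by
  induction h : T.dist o v generalizing v with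
  | zero => omega
  | succ n ih =>
    obtain ⟨u, hu⟩ := exists_parent hT.connected (o := o) (v := v) (by rintro rfl; simp at h)
    have h2 := hu.2
    rcases Nat.lt_succ_iff_lt_or_eq.1 (h ▸ hm) with hmn | rfl
    -- An edge separating the parent `u` also separates `v`: the edge from `u` to `v` starts at a
    -- deeper level than `x`, so it survives the deletion.
    · obtain ⟨x, y, hxy, hx, hr, -⟩ := ih u (by omega) (by omega)
      refine ⟨x, y, hxy, hx, fun hv => hr (hv.trans
        (hu.adj_deleteEdges (Or.inr ?_) hxy).symm.reachable), by omega⟩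
      rintro rfl
      omega
    · exact ⟨u, v, hu, by omega, not_reachable_child hT hu, fun _ => rfl⟩

end RootedTree

/-! ### Separating edges of prescribed length in an HST -/

namespace HSTEmbedding

variable {V M : Type*} [Fintype M] {X : Finset V} {d : V → V → ℝ} (T : HSTEmbedding X d M)

theorem weight_eq {y₀ : M} (h₀ : IsChild T.net.graph T.root T.root y₀) {x y : M}
    (hxy : IsChild T.net.graph T.root x y) :
    T.net.weight s(x, y) = T.net.weight s(T.root, y₀) / 2 ^ (T.net.graph.dist T.root x) := by
  induction h : T.net.graph.dist T.root x generalizing x y with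
  | zero =>
    obtain rfl := T.isTree.connected.dist_eq_zero_iff.1 h
    simpa using T.length_siblings _ _ _ hxy h₀
  | succ n ih =>
    obtain ⟨u, hu⟩ := exists_parent T.isTree.connected (o := T.root) (v := x)
      (by rintro hx; simp [hx] at h)
    have h2 := hu.2
    rw [T.length_halves u x y hu hxy, ih hu (by omega)]
    field_simp
    ring

/-- Lengths halve along the descent, so the path from the root is a geometric series with first term
the length of a top edge. -/
theorem dist_root_le {y₀ : M} (h₀ : IsChild T.net.graph T.root T.root y₀) (v : M) :
    T.net.dist T.root v ≤
      2 * T.net.weight s(T.root, y₀) * (1 - 1 / 2 ^ (T.net.graph.dist T.root v)) := by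
  induction h : T.net.graph.dist T.root v generalizing v with
  | zero =>
    obtain rfl := T.isTree.connected.dist_eq_zero_iff.1 h
    simp [Network.dist_self]
  | succ n ih =>
    obtain ⟨u, hu⟩ := exists_parent T.isTree.connected (o := T.root) (v := v)
      (by rintro hx; simp [hx] at h)
    have h2 := hu.2
    have h3 := ih u (by omega)
    have h4 := T.net.dist_triangle T.root u v
    have h5 := T.net.dist_le_weight hu.1
    rw [T.weight_eq h₀ hu, (by omega : T.net.graph.dist T.root u = n)] at h5
    have h6 : 2 * T.net.weight s(T.root, y₀) * (1 - 1 / 2 ^ (n + 1)) =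
        2 * T.net.weight s(T.root, y₀) * (1 - 1 / 2 ^ n)
          + T.net.weight s(T.root, y₀) / 2 ^ n := by
      field_simp
      ring
    linarith

/-- If `u` is at distance at least `2 ^ j` from `r`, some edge of length at least `2 ^ (j - 2)`
separates `u` from `r` and from the root, and it cuts off a set of diameter less than
`2 ^ (j - 1)`. -/
theorem exists_cut (hd : ∀ v, d v v = 0) {u r : V} (hu : u ∈ X) (hr : r ∈ X) {j : ℤ}
    (hj : (2 : ℝ) ^ j ≤ d u r) :
    ∃ e ∈ T.net.graph.edgeSet, (2 : ℝ) ^ (j - 2) ≤ T.net.weight e ∧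
      ¬ (T.net.graph.deleteEdges {e}).Reachable T.root (T.leaf u) ∧
      (T.net.graph.deleteEdges {e}).Reachable T.root (T.leaf r) ∧
      ∀ a ∈ X, ∀ b ∈ X, ¬ (T.net.graph.deleteEdges {e}).Reachable T.root (T.leaf a) →
        ¬ (T.net.graph.deleteEdges {e}).Reachable T.root (T.leaf b) → d a b < (2 : ℝ) ^ (j - 1) := by
  have hjpos : (0 : ℝ) < 2 ^ j := by positivity
  suffices H : ∃ e ∈ T.net.graph.edgeSet, (2 : ℝ) ^ (j - 2) ≤ T.net.weight e ∧
      ¬ (T.net.graph.deleteEdges {e}).Reachable T.root (T.leaf u) ∧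
      ∀ a ∈ X, ∀ b ∈ X, ¬ (T.net.graph.deleteEdges {e}).Reachable T.root (T.leaf a) →
        ¬ (T.net.graph.deleteEdges {e}).Reachable T.root (T.leaf b) →
          d a b < (2 : ℝ) ^ (j - 1) by
    obtain ⟨e, he, hw, hcu, hcut⟩ := H
    refine ⟨e, he, hw, hcu, ?_, hcut⟩
    -- If the edge cut off `r` together with `u`, the diameter bound would contradict `hj`.
    by_contra hcr
    have h1 := hcut u hu r hr hcu hcr
    have h2 : (2 : ℝ) ^ (j - 1) ≤ 2 ^ j := zpow_le_zpow_right₀ (by norm_num) (by omega)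
    linarith
  have hne : T.leaf u ≠ T.leaf r := by
    intro h
    rw [T.leaves.injOn hu hr h, hd] at hj
    linarith
  have hnochild := T.leaves.mapsTo hu
  -- The tree root is not the leaf of `u`: it has a child, on the way to the different leaf of `r`.
  have hpos : 0 < T.net.graph.dist T.root (T.leaf u) := by
    refine T.isTree.connected.pos_dist_of_ne fun h => ?_
    obtain ⟨x, y, hxy, hx, -⟩ := exists_separating_edge T.isTree (o := T.root) 0 (T.leaf r)
      (T.isTree.connected.pos_dist_of_ne (h ▸ hne))
    rw [← T.isTree.connected.dist_eq_zero_iff.1 hx, h] at hxy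
    exact hnochild y (by rwa [h])
  obtain ⟨x₀, y₀, h₀, hx₀, -⟩ := exists_separating_edge T.isTree (o := T.root) 0 (T.leaf u) hpos
  obtain rfl := T.isTree.connected.dist_eq_zero_iff.1 hx₀
  obtain ⟨t, ht⟩ := T.length_pow s(T.root, y₀) h₀.1
  -- Both leaves are at distance less than `2 * 2 ^ t` from the root, and the embedding is
  -- expanding. Hence the top edges are longer than `2 ^ (j - 2)`.
  have hjt : j < t + 2 := by
    have h1 := T.expanding u hu r hr
    have h2 := T.net.dist_triangle (T.leaf u) T.root (T.leaf r)
    rw [T.net.dist_comm (T.leaf u) T.root] at h2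
    have key : ∀ v, T.net.dist T.root v < 2 * (2 : ℝ) ^ t := by
      intro v
      refine (T.dist_root_le h₀ v).trans_lt ?_
      rw [ht]
      have : (0 : ℝ) < 2 ^ t := by positivity
      have : (0 : ℝ) < 1 / 2 ^ (T.net.graph.dist T.root v) := by positivity
      nlinarith
    have h3 := key (T.leaf u)
    have h4 := key (T.leaf r)
    have h5 : (2 : ℝ) ^ (t + 2) = 4 * 2 ^ t := by
      rw [zpow_add₀ two_ne_zero]; norm_num; ring
    refine (zpow_lt_zpow_iff_right₀ (one_lt_two (α := ℝ))).1 ?_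
    linarith
  have hw : ∀ x y, IsChild T.net.graph T.root x y →
      T.net.weight s(x, y) = (2 : ℝ) ^ (t - T.net.graph.dist T.root x) := by
    intro x y hxy
    rw [T.weight_eq h₀ hxy, ht, zpow_sub₀ two_ne_zero, zpow_natCast]
  -- If even the edge at the leaf has length at least `2 ^ (j - 2)`, it serves, as it cuts off `u`
  -- alone. Otherwise, by halving, some edge above `u` has length exactly `2 ^ (j - 2)`, and
  -- `cut_diam` applies.
  by_cases hc : j - 2 ≤ t - (T.net.graph.dist T.root (T.leaf u) - 1)
  · obtain ⟨x, y, hxy, hx, hcu, hy⟩ := exists_separating_edge T.isTree (o := T.root)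
      (T.net.graph.dist T.root (T.leaf u) - 1) (T.leaf u) (by omega)
    obtain rfl := hy (by omega)
    have hall : ∀ a ∈ X, ¬ (T.net.graph.deleteEdges {s(x, T.leaf u)}).Reachable T.root (T.leaf a) →
        a = u := by
      intro a ha hna
      by_contra hau
      exact hna (reachable_of_ne_leaf T.isTree.connected hxy hnochild _
        fun h => hau (T.leaves.injOn ha hu h))
    refine ⟨s(x, T.leaf u), hxy.1, ?_, hcu, fun a ha b hb hna hnb => ?_⟩
    · rw [hw _ _ hxy, hx]
      exact zpow_le_zpow_right₀ (by norm_num) (by omega)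
    · rw [hall a ha hna, hall b hb hnb, hd]
      positivity
  · obtain ⟨x, y, hxy, hx, hcu, -⟩ := exists_separating_edge T.isTree (o := T.root)
      (t - (j - 2)).toNat (T.leaf u) (by omega)
    have hwe : T.net.weight s(x, y) = (2 : ℝ) ^ (j - 2) := by
      rw [hw _ _ hxy, hx]
      congr 1
      omega
    refine ⟨s(x, y), hxy.1, hwe.ge, hcu, fun a ha b hb hna hnb => ?_⟩
    exact T.cut_diam s(x, y) hxy.1 (j - 1) (by rw [hwe]; congr 1; omega) a ha b hb hna hnb

end HSTEmbedding

/-! ### Charging shares to HST edges -/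

theorem sum_two_zpow_le (F : Finset ℤ) (J : ℤ) (hF : ∀ j ∈ F, j ≤ J) :
    ∑ j ∈ F, (2 : ℝ) ^ j ≤ (2 : ℝ) ^ (J + 1) := by
  -- Substituting `n = J - j` makes this a partial sum of the geometric series of ratio one half.
  have h1 : ∑ j ∈ F, (2 : ℝ) ^ j
      = ∑ n ∈ F.image (fun j => (J - j).toNat), (2 : ℝ) ^ J * (1 / 2) ^ n := by
    rw [Finset.sum_image]
    · refine Finset.sum_congr rfl fun j hj => ?_
      have := hF j hj
      rw [one_div, inv_pow, ← zpow_natCast, Int.toNat_of_nonneg (by omega), ← div_eq_mul_inv,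
        ← zpow_sub₀ two_ne_zero]
      congr 1
      omega
    · intro a ha b hb hab
      have := hF a ha
      have := hF b hb
      simp only at hab
      omega
  rw [h1, ← Finset.mul_sum, zpow_add_one₀ two_ne_zero]
  refine mul_le_mul_of_nonneg_left ?_ (by positivity)
  exact (summable_geometric_two.sum_le_tsum _ fun _ _ => by positivity).trans_eq
    tsum_geometric_two

section Run

variable {V : Type*} [Fintype V] (N : Network V) (r : V)

/-- The shares of entries that are close to each other, class by class, add up geometrically. -/
theorem shareSum_close_le (σ : List (Request V)) (J : ℤ) (Q : Share V → Prop)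
    (hJ : ∀ x ∈ (run N r σ).shares, Q x → x.cls ≤ J)
    (hQ : ∀ x ∈ (run N r σ).shares, ∀ y ∈ (run N r σ).shares, Q x → Q y → x.cls = y.cls →
      N.dist x.vertex y.vertex < (2 : ℝ) ^ (x.cls - 1)) :
    shareSum (run N r σ).shares Q ≤ (2 : ℝ) ^ (J + 2) := by
  let F := ((run N r σ).shares.map Share.cls).toFinset.filter (· ≤ J)
  -- `shareSum_class_le` needs a predicate on vertices, so `Q` is replaced, class by class, by
  -- membership among the vertices of entries satisfying it.
  have h1 := shareSum_le_sum (share_nonneg N r (σ := σ)) (P := Q) F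
    (fun j x => x.cls = j ∧ ∃ y ∈ (run N r σ).shares, Q y ∧ y.cls = j ∧ y.vertex = x.vertex)
    (fun x hx hQx => ⟨x.cls, by
      simp only [F, Finset.mem_filter, List.mem_toFinset, List.mem_map]
      exact ⟨⟨x, hx, rfl⟩, hJ x hx hQx⟩, rfl, x, hx, hQx, rfl, rfl⟩)
  refine h1.trans ?_
  have h2 : ∀ j ∈ F, shareSum (run N r σ).shares (fun x => x.cls = j ∧
      ∃ y ∈ (run N r σ).shares, Q y ∧ y.cls = j ∧ y.vertex = x.vertex) ≤ 2 * (2 : ℝ) ^ j := by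
    intro j _
    rw [← zpow_one_add₀ two_ne_zero, add_comm]
    refine shareSum_class_le N r σ j
      (fun v => ∃ y ∈ (run N r σ).shares, Q y ∧ y.cls = j ∧ y.vertex = v) ?_
    rintro u v ⟨x, hx, hQx, rfl, rfl⟩ ⟨y, hy, hQy, hxy, rfl⟩
    exact hQ x hx y hy hQx hQy hxy.symm
  refine (Finset.sum_le_sum h2).trans ?_
  rw [← Finset.mul_sum]
  have h3 := sum_two_zpow_le F J fun j hj => (Finset.mem_filter.1 hj).2
  have h4 : (2 : ℝ) ^ (J + 2) = 2 * 2 ^ (J + 1) := by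
    rw [← zpow_one_add₀ two_ne_zero]; congr 1; ring
  linarith

theorem vertex_mem_terminals {σ : List (Request V)} {x : Share V}
    (hx : x ∈ (run N r σ).shares) : x.vertex ∈ terminals r σ := by
  have := (shares_run_spec N r σ x hx).2.1
  simp only [terminals, Finset.mem_insert, List.mem_toFinset]
  exact Or.inr this

theorem exists_opt_eq (σ : List (Request V)) :
    ∃ H ⊆ N.edges, N.opt r σ = N.solutionCost r σ H := by
  obtain ⟨H, hH, h⟩ := Finset.exists_mem_eq_inf' (s := N.edges.powerset) ⟨∅, by simp⟩
    (N.solutionCost r σ)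
  exact ⟨H, Finset.mem_powerset.1 hH, h⟩

theorem penalties_nonneg {V : Type*} (σ : List (Request V)) (P : V → Prop) :
    0 ≤ (σ.map fun q => if P q.vertex then 0 else q.penalty).sum := by
  apply List.sum_nonneg
  intro y hy
  obtain ⟨q, -, rfl⟩ := List.mem_map.1 hy
  split_ifs
  exacts [le_rfl, q.penalty_nonneg]

theorem opt_nonneg (σ : List (Request V)) : 0 ≤ N.opt r σ := by
  obtain ⟨H, -, h⟩ := exists_opt_eq N r σ
  rw [h, Network.solutionCost]
  exact add_nonneg (N.edgeCost_nonneg H) (penalties_nonneg σ fun v => ConnectedIn H v r)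

/-- The shares of the terminals that an edge set of an HST embedding connects to the root. -/
theorem shareSum_tree_le (σ : List (Request V)) {M : Type*} [Fintype M]
    (T : HSTEmbedding (terminals r σ) N.dist M) {H : Finset (Sym2 M)} (hH : H ⊆ T.net.edges) :
    shareSum (run N r σ).shares (fun x => ConnectedIn H (T.leaf x.vertex) (T.leaf r))
      ≤ 16 * T.net.edgeCost H := by
  have h1 := shareSum_le_sum (share_nonneg N r (σ := σ))
    (P := fun x => ConnectedIn H (T.leaf x.vertex) (T.leaf r)) H
    (fun e x => (2 : ℝ) ^ (x.cls - 2) ≤ T.net.weight e ∧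
      ¬ (T.net.graph.deleteEdges {e}).Reachable T.root (T.leaf x.vertex) ∧
      ∀ a ∈ terminals r σ, ∀ b ∈ terminals r σ,
        ¬ (T.net.graph.deleteEdges {e}).Reachable T.root (T.leaf a) →
        ¬ (T.net.graph.deleteEdges {e}).Reachable T.root (T.leaf b) →
          N.dist a b < (2 : ℝ) ^ (x.cls - 1)) (by
    intro x hx hc
    obtain ⟨e, he, hw, hcu, hcr, hcut⟩ := T.exists_cut N.dist_self
      (vertex_mem_terminals N r hx) (by simp [terminals]) (shares_run_spec N r σ x hx).2.2
    refine ⟨e, ?_, hw, hcu, hcut⟩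
    -- Were `e` not in `H`, the connection from the terminal to `r` inside `H` would survive the
    -- deletion of `e`.
    by_contra heH
    refine hcu (hcr.trans (SimpleGraph.Reachable.mono ?_ hc).symm)
    intro a b hab
    rw [SimpleGraph.fromEdgeSet_adj] at hab
    rw [SimpleGraph.deleteEdges_adj]
    have hab' := hH (Finset.mem_coe.1 hab.1)
    simp only [Network.edges, Finset.mem_filter, Finset.mem_univ, true_and,
      SimpleGraph.mem_edgeSet] at hab'
    exact ⟨hab', fun h => heH (Set.mem_singleton_iff.1 h ▸ Finset.mem_coe.1 hab.1)⟩)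
  refine h1.trans ?_
  unfold Network.edgeCost
  rw [Finset.mul_sum]
  refine Finset.sum_le_sum fun e he => ?_
  have he' : e ∈ T.net.graph.edgeSet := by simpa [Network.edges] using hH he
  obtain ⟨t, ht⟩ := T.length_pow e he'
  -- An edge of length `2 ^ t` is charged only by classes up to `t + 2`, whose bounds sum to at most
  -- `2 ^ (t + 4)`.
  have h2 : (16 : ℝ) * T.net.weight e = 2 ^ (t + 2 + 2) := by
    rw [ht, add_assoc, zpow_add₀ two_ne_zero]; norm_num; ring
  rw [h2]
  refine shareSum_close_le N r σ (t + 2) _ ?_ ?_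
  · rintro x hx ⟨hw, -⟩
    rw [ht] at hw
    have := (zpow_le_zpow_iff_right₀ (one_lt_two (α := ℝ))).1 hw
    omega
  · rintro x hx y hy ⟨-, h1, h2⟩ ⟨-, h3, -⟩ -
    exact h2 _ (vertex_mem_terminals N r hx) _ (vertex_mem_terminals N r hy) h1 h3

theorem cost_le_opt_tree (σ : List (Request V)) {M : Type*} [Fintype M]
    (T : HSTEmbedding (terminals r σ) N.dist M) :
    (costShareAlgorithm N r).cost N σ ≤ 32 * T.opt r σ := by
  obtain ⟨H, hH, hopt⟩ := exists_opt_eq T.net (T.leaf r) (σ.map (Request.map T.leaf))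
  have h1 := cost_le_shareSum N r σ
  have h2 := shareSum_le_connected N r σ (fun v => ConnectedIn H (T.leaf v) (T.leaf r))
  have h3 := shareSum_tree_le N r σ T hH
  have h4 := penalties_nonneg σ (fun v => ConnectedIn H (T.leaf v) (T.leaf r))
  have h5 : T.opt r σ = T.net.edgeCost H + (σ.map fun q =>
      if ConnectedIn H (T.leaf q.vertex) (T.leaf r) then 0 else q.penalty).sum := by
    rw [HSTEmbedding.opt, hopt, Network.solutionCost, List.map_map]
    rfl
  linarith

end Run

/-! ### Lower bounds on edge cost by test functions -/

section Variation

variable {V : Type*}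

/-- The absolute difference of the values of `f` at the two ends of an edge. -/
def variation (f : V → ℝ) : Sym2 V → ℝ :=
  Sym2.lift ⟨fun a b => |f a - f b|, fun _ _ => abs_sub_comm _ _⟩

theorem variation_mk (f : V → ℝ) (a b : V) : variation f s(a, b) = |f a - f b| := rfl

theorem variation_nonneg (f : V → ℝ) (e : Sym2 V) : 0 ≤ variation f e := by
  induction e with
  | h a b => exact abs_nonneg _

theorem abs_sub_le_sum_variation (f : V → ℝ) {G : SimpleGraph V} {u v : V} (p : G.Walk u v) :
    |f u - f v| ≤ (p.edges.map (variation f)).sum := by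
  induction p with
  | nil => simp
  | @cons a b c h p ih =>
    simp only [SimpleGraph.Walk.edges_cons, List.map_cons, List.sum_cons, variation_mk]
    exact (abs_sub_le _ (f b) _).trans (by gcongr)

/-- Differences telescope along a path in `H`, which uses each edge at most once. -/
theorem abs_sub_le_of_connectedIn (f : V → ℝ) {H : Finset (Sym2 V)} {u v : V}
    (h : ConnectedIn H u v) : |f u - f v| ≤ ∑ e ∈ H, variation f e := by
  obtain ⟨p, hp⟩ := h.exists_isPath
  refine (abs_sub_le_sum_variation f p).trans ?_
  rw [← List.sum_toFinset _ hp.isTrail.edges_nodup]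
  refine Finset.sum_le_sum_of_subset_of_nonneg (fun e he => ?_) fun e _ _ => variation_nonneg f e
  have := SimpleGraph.Walk.edges_subset_edgeSet p (List.mem_toFinset.1 he)
  rw [SimpleGraph.edgeSet_fromEdgeSet] at this
  exact Finset.mem_coe.1 this.1

end Variation

namespace Network

variable {V : Type*} [Fintype V] (N : Network V)

/-- The test function is the distance to `v`, whose variation on an edge is at most the weight. -/
theorem dist_le_edgeCost {H : Finset (Sym2 V)} (hH : H ⊆ N.edges) {u v : V}
    (h : ConnectedIn H u v) : N.dist u v ≤ N.edgeCost H := by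
  have h1 := abs_sub_le_of_connectedIn (fun x => N.dist x v) h
  rw [N.dist_self, sub_zero, abs_of_nonneg (N.dist_nonneg _ _)] at h1
  refine h1.trans (Finset.sum_le_sum fun e he => ?_)
  have he := hH he
  induction e with
  | h a b =>
    have hab : N.graph.Adj a b := by simpa [edges] using he
    have h2 := N.dist_le_weight hab
    have h3 := N.dist_triangle a b v
    have h4 := N.dist_triangle b a v
    rw [N.dist_comm b a] at h4
    rw [variation_mk, abs_le]
    constructor <;> linarith

/-- Greedy choice: a point joins the net only if no net point is within `δ`. -/
theorem exists_net (S : Finset V) {δ : ℝ} (hδ : 0 < δ) :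
    ∃ K ⊆ S, (∀ u ∈ K, ∀ v ∈ K, u ≠ v → δ ≤ N.dist u v) ∧ ∀ s ∈ S, ∃ u ∈ K, N.dist s u < δ := by
  induction S using Finset.induction with
  | empty => exact ⟨∅, by simp⟩
  | insert a S _ ih =>
    obtain ⟨K, hKS, hsep, hcov⟩ := ih
    by_cases ha : ∃ u ∈ K, N.dist a u < δ
    · refine ⟨K, hKS.trans (Finset.subset_insert _ _), hsep, fun s hs => ?_⟩
      rcases Finset.mem_insert.1 hs with rfl | hs
      exacts [ha, hcov s hs]
    · push Not at ha
      refine ⟨insert a K, Finset.insert_subset_insert _ hKS, fun u hu v hv huv => ?_,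
        fun s hs => ?_⟩
      · rcases Finset.mem_insert.1 hu with rfl | hu' <;>
          rcases Finset.mem_insert.1 hv with rfl | hv'
        · exact absurd rfl huv
        · exact ha v hv'
        · rw [N.dist_comm]; exact ha u hu'
        · exact hsep u hu' v hv' huv
      · rcases Finset.mem_insert.1 hs with rfl | hs
        · exact ⟨s, by simp, by rwa [N.dist_self]⟩
        · obtain ⟨u, hu, h⟩ := hcov s hs
          exact ⟨u, Finset.mem_insert_of_mem hu, h⟩

/-- A set of points at distance at least `2 * R` from each other that are connected to a point at
distance at least `R` is expensive. -/
theorem card_mul_le_edgeCost {H : Finset (Sym2 V)} (hH : H ⊆ N.edges) (r : V) (K : Finset V)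
    {R : ℝ} (hR : 0 ≤ R) (hsep : ∀ u ∈ K, ∀ v ∈ K, u ≠ v → 2 * R ≤ N.dist u v)
    (hr : ∀ v ∈ K, R ≤ N.dist v r) (hc : ∀ v ∈ K, ConnectedIn H v r) :
    K.card * R ≤ 2 * N.edgeCost H := by
  -- The test function of `v` is the distance truncated at `R`: it is `0` at `v`, `R` at `r`, and
  -- constant outside the ball around `v`.
  have h1 : ∀ v ∈ K, R ≤ ∑ e ∈ H, variation (fun a => min (N.dist v a) R) e := by
    intro v hv
    have := abs_sub_le_of_connectedIn (fun a => min (N.dist v a) R) (hc v hv)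
    rwa [N.dist_self, min_eq_left hR, min_eq_right (hr v hv), zero_sub, abs_neg,
      abs_of_nonneg hR] at this
  -- The balls of radius `R` are disjoint, so each vertex lies in at most one of them. An edge has
  -- two ends, hence the factor `2` in `h2`.
  have hball : ∀ a : V, ∀ w : ℝ, 0 ≤ w → ∑ v ∈ K, (if N.dist v a < R then w else 0) ≤ w := by
    intro a w hw
    rw [← Finset.sum_filter, Finset.sum_const, nsmul_eq_mul]
    refine mul_le_of_le_one_left hw ?_
    have : (K.filter fun v => N.dist v a < R).card ≤ 1 := by
      refine Finset.card_le_one.2 fun u hu v hv => ?_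
      rw [Finset.mem_filter] at hu hv
      by_contra huv
      have h2 := hsep u hu.1 v hv.1 huv
      have h3 := N.dist_triangle u a v
      rw [N.dist_comm a v] at h3
      linarith [hu.2, hv.2]
    exact_mod_cast this
  have h2 : ∀ e ∈ H, ∑ v ∈ K, variation (fun a => min (N.dist v a) R) e ≤ 2 * N.weight e := by
    intro e he
    have he := hH he
    induction e with
    | h a b =>
      have hab : N.graph.Adj a b := by simpa [edges] using he
      have hw := N.dist_le_weight hab
      have hw0 := N.weight_nonneg s(a, b)
      have h3 := hball a _ hw0
      have h4 := hball b _ hw0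
      refine le_trans (Finset.sum_le_sum (g := fun v => (if N.dist v a < R then N.weight s(a, b)
        else 0) + if N.dist v b < R then N.weight s(a, b) else 0) fun v _ => ?_)
        (by rw [Finset.sum_add_distrib]; linarith)
      rw [variation_mk]
      by_cases ha : N.dist v a < R
      · have h5 : |min (N.dist v a) R - min (N.dist v b) R| ≤ |N.dist v a - N.dist v b| := by
          simpa using abs_min_sub_min_le_max (N.dist v a) R (N.dist v b) R
        have h6 : |N.dist v a - N.dist v b| ≤ N.weight s(a, b) := by
          have h3 := N.dist_triangle v a b
          have h4 := N.dist_triangle v b a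
          rw [N.dist_comm b a] at h4
          rw [abs_le]
          constructor <;> linarith
        rw [if_pos ha]
        split_ifs <;> linarith
      · by_cases hb : N.dist v b < R
        · have h5 : |min (N.dist v a) R - min (N.dist v b) R| ≤ |N.dist v a - N.dist v b| := by
            simpa using abs_min_sub_min_le_max (N.dist v a) R (N.dist v b) R
          have h6 : |N.dist v a - N.dist v b| ≤ N.weight s(a, b) := by
            have h3 := N.dist_triangle v a b
            have h4 := N.dist_triangle v b a
            rw [N.dist_comm b a] at h4
            rw [abs_le]
            constructor <;> linarith
          rw [if_neg ha, if_pos hb]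
          linarith
        · rw [min_eq_right (not_lt.1 ha), min_eq_right (not_lt.1 hb), if_neg ha, if_neg hb]
          simp
  calc (K.card : ℝ) * R = ∑ v ∈ K, R := by simp
    _ ≤ ∑ v ∈ K, ∑ e ∈ H, variation (fun a => min (N.dist v a) R) e := Finset.sum_le_sum h1
    _ = ∑ e ∈ H, ∑ v ∈ K, variation (fun a => min (N.dist v a) R) e := Finset.sum_comm
    _ ≤ ∑ e ∈ H, 2 * N.weight e := Finset.sum_le_sum h2
    _ = 2 * N.edgeCost H := by rw [edgeCost, Finset.mul_sum]

end Network

/-! ### The logarithmic bound in the graph -/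

section Run

variable {V : Type*} [Fintype V] (N : Network V) (r : V)

/-- The shares of one class of the terminals that an edge set connects to the root. -/
theorem shareSum_class_connected_le (σ : List (Request V)) {H : Finset (Sym2 V)}
    (hH : H ⊆ N.edges) (j : ℤ) :
    shareSum (run N r σ).shares (fun x => x.cls = j ∧ ConnectedIn H x.vertex r)
      ≤ 32 * N.edgeCost H := by
  let S : Finset V := Finset.univ.filter fun v =>
    ∃ x ∈ (run N r σ).shares, x.cls = j ∧ ConnectedIn H x.vertex r ∧ x.vertex = v
  have hS : ∀ v ∈ S, ConnectedIn H v r ∧ (2 : ℝ) ^ j ≤ N.dist v r := by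
    intro v hv
    obtain ⟨x, hx, rfl, hc, rfl⟩ := (Finset.mem_filter.1 hv).2
    exact ⟨hc, (shares_run_spec N r σ x hx).2.2⟩
  have e1 : (2 : ℝ) ^ (j - 2) = 2 * 2 ^ (j - 3) := by
    rw [← zpow_one_add₀ two_ne_zero]; congr 1; ring
  have e2 : (2 : ℝ) ^ (j - 1) = 2 * 2 ^ (j - 2) := by
    rw [← zpow_one_add₀ two_ne_zero]; congr 1; ring
  have e3 : (2 : ℝ) ^ j = 2 * 2 ^ (j - 1) := by
    rw [← zpow_one_add₀ two_ne_zero]; congr 1; ring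
  have e4 : (2 : ℝ) ^ (j + 1) = 2 * 2 ^ j := by
    rw [← zpow_one_add₀ two_ne_zero]; congr 1; ring
  have e0 : (0 : ℝ) < 2 ^ (j - 3) := by positivity
  -- The separation `2 ^ (j - 2)` is `2 * R` for packing radius `R = 2 ^ (j - 3)`, and small enough
  -- for each cluster to have diameter less than `2 ^ (j - 1)`. A cluster carries at most `2 ^ (j +
  -- 1) = 16 * R`, and packing gives `K.card * R ≤ 2 * c(H)`, hence `32`.
  obtain ⟨K, hKS, hsep, hcov⟩ := N.exists_net S (δ := (2 : ℝ) ^ (j - 2)) (by positivity)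
  have h1 := N.card_mul_le_edgeCost hH r K e0.le (fun u hu v hv huv => e1 ▸ hsep u hu v hv huv)
    (fun v hv => by linarith [(hS v (hKS hv)).2]) fun v hv => (hS v (hKS hv)).1
  have h2 := shareSum_le_sum (share_nonneg N r (σ := σ))
    (P := fun x => x.cls = j ∧ ConnectedIn H x.vertex r) K
    (fun u x => x.cls = j ∧ N.dist x.vertex u < (2 : ℝ) ^ (j - 2)) (fun x hx hc => by
      obtain ⟨u, hu, h⟩ := hcov x.vertex (Finset.mem_filter.2
        ⟨Finset.mem_univ _, x, hx, hc.1, hc.2, rfl⟩)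
      exact ⟨u, hu, hc.1, h⟩)
  have h3 : ∀ u ∈ K, shareSum (run N r σ).shares
      (fun x => x.cls = j ∧ N.dist x.vertex u < (2 : ℝ) ^ (j - 2)) ≤ (2 : ℝ) ^ (j + 1) :=
    fun u _ => shareSum_class_le N r σ j (fun v => N.dist v u < (2 : ℝ) ^ (j - 2))
      fun a b ha hb => by
        have := N.dist_triangle a u b
        rw [N.dist_comm u b] at this
        linarith
  have h4 := h2.trans (Finset.sum_le_sum h3)
  rw [Finset.sum_const, nsmul_eq_mul] at h4
  rw [show (2 : ℝ) ^ (j + 1) = 16 * 2 ^ (j - 3) by linarith] at h4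
  linarith

/-- The shares of the terminals that an edge set of the graph connects to the root. -/
theorem shareSum_connected_le (σ : List (Request V)) {H : Finset (Sym2 V)} (hH : H ⊆ N.edges) :
    shareSum (run N r σ).shares (fun x => ConnectedIn H x.vertex r)
      ≤ (4 + 32 * Nat.clog 2 (terminals r σ).card) * N.edgeCost H := by
  have hnn := share_nonneg N r (σ := σ)
  by_cases hex : ∃ x ∈ (run N r σ).shares, ConnectedIn H x.vertex r
  swap
  · rw [shareSum_eq_zero fun x hx hc => hex ⟨x, hx, hc⟩]
    have := N.edgeCost_nonneg H
    positivity
  have hle : ∀ x ∈ (run N r σ).shares, ConnectedIn H x.vertex r →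
      (2 : ℝ) ^ x.cls ≤ N.edgeCost H := fun x hx hc =>
    (shares_run_spec N r σ x hx).2.2.trans (N.dist_le_edgeCost hH hc)
  have hpos : 0 < N.edgeCost H := by
    obtain ⟨x, hx, hc⟩ := hex
    exact lt_of_lt_of_le (by positivity) (hle x hx hc)
  set c := N.edgeCost H
  set J := Int.log 2 c
  set k := (terminals r σ).card
  set L := Nat.clog 2 k
  have hJ1 : (2 : ℝ) ^ J ≤ c := by exact_mod_cast Int.zpow_log_le_self (b := 2) (by norm_num) hpos
  have hJ2 : c < (2 : ℝ) ^ (J + 1) := by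
    exact_mod_cast Int.lt_zpow_succ_log_self (b := 2) (by norm_num) c
  have hcls : ∀ x ∈ (run N r σ).shares, ConnectedIn H x.vertex r → x.cls ≤ J := by
    intro x hx hc
    have := (zpow_lt_zpow_iff_right₀ (one_lt_two (α := ℝ))).1 ((hle x hx hc).trans_lt hJ2)
    omega
  have h1 := shareSum_or_le hnn (P := fun x => ConnectedIn H x.vertex r)
    (Q := fun x => x.cls ≤ J - L)
    (R := fun x => ConnectedIn H x.vertex r ∧ J - L < x.cls)
    (fun x _ hc => (le_or_gt x.cls (J - L)).imp id fun h => ⟨hc, h⟩)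
  -- Low classes: each of the `k ≤ 2 ^ L` vertices carries at most `2 ^ (J - L + 2)`, whether
  -- connected or not.
  have h2 : shareSum (run N r σ).shares (fun x => x.cls ≤ J - L) ≤ 4 * c := by
    have h3 := shareSum_le_sum hnn (P := fun x => x.cls ≤ J - L) (terminals r σ)
      (fun v x => x.vertex = v ∧ x.cls ≤ J - L)
      (fun x hx h => ⟨x.vertex, vertex_mem_terminals N r hx, rfl, h⟩)
    have h4 : ∀ v ∈ terminals r σ, shareSum (run N r σ).shares
        (fun x => x.vertex = v ∧ x.cls ≤ J - L) ≤ (2 : ℝ) ^ (J - L + 2) := fun v _ =>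
      shareSum_close_le N r σ (J - L) _ (fun x _ h => h.2) (by
        rintro x - y - ⟨hx, -⟩ ⟨hy, -⟩ -
        rw [hx, hy, N.dist_self]
        positivity)
    have h5 := h3.trans (Finset.sum_le_sum h4)
    rw [Finset.sum_const, nsmul_eq_mul] at h5
    have hk : (k : ℝ) ≤ 2 ^ L := by exact_mod_cast Nat.le_pow_clog (by norm_num) k
    have h6 : (k : ℝ) * 2 ^ (J - L + 2) ≤ 2 ^ L * 2 ^ (J - L + 2) := by gcongr
    have h7 : (2 : ℝ) ^ L * 2 ^ (J - L + 2) = 4 * 2 ^ J := by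
      rw [← zpow_natCast, ← zpow_add₀ two_ne_zero,
        show (L : ℤ) + (J - L + 2) = J + 2 by ring, zpow_add₀ two_ne_zero]
      norm_num
      ring
    linarith
  -- The remaining classes lie in the interval from `J - L + 1` to `J`, which has `L` elements.
  have h3 : shareSum (run N r σ).shares (fun x => ConnectedIn H x.vertex r ∧ J - L < x.cls)
      ≤ 32 * L * c := by
    have h4 := shareSum_le_sum hnn
      (P := fun x => ConnectedIn H x.vertex r ∧ J - L < x.cls) (Finset.Ioc (J - L) J)
      (fun j x => x.cls = j ∧ ConnectedIn H x.vertex r)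
      (fun x hx h => ⟨x.cls, Finset.mem_Ioc.2 ⟨h.2, hcls x hx h.1⟩, rfl, h.1⟩)
    refine (h4.trans (Finset.sum_le_sum fun j _ =>
      shareSum_class_connected_le N r σ hH j)).trans_eq ?_
    rw [Finset.sum_const, nsmul_eq_mul, Int.card_Ioc]
    simp
    ring
  linarith

theorem cost_le_log_opt (σ : List (Request V)) :
    (costShareAlgorithm N r).cost N σ ≤
      272 * Real.log ((terminals r σ).card : ℝ) * N.opt r σ := by
  have h1 := cost_le_shareSum N r σ
  have hrmem : r ∈ terminals r σ := by simp [terminals]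
  rcases Nat.lt_or_ge 1 (terminals r σ).card with hk | hk
  · obtain ⟨H, hH, hopt⟩ := exists_opt_eq N r σ
    have h2 := shareSum_le_connected N r σ (fun v => ConnectedIn H v r)
    have h3 := shareSum_connected_le N r σ hH
    rw [hopt, Network.solutionCost]
    have hpen := penalties_nonneg σ (fun v => ConnectedIn H v r)
    have hc := N.edgeCost_nonneg H
    revert h2 h3 hpen hc
    generalize (σ.map fun q => if ConnectedIn H q.vertex r then 0 else q.penalty).sum = p
    generalize N.edgeCost H = c
    intro h2 h3 hpen hc
    generalize (terminals r σ).card = k at *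
    have hlog2 : (1 / 2 : ℝ) < Real.log 2 := by linarith [Real.log_two_gt_d9]
    have hk2 : Real.log 2 ≤ Real.log k :=
      Real.log_le_log (by norm_num) (by exact_mod_cast hk)
    -- As `log 2 > 1 / 2`, both `clog 2 k - 1` and `1` are at most `2 * log k`. Then `4 + 32 * 4 *
    -- log k ≤ 136 * log k`, and doubling gives `272`.
    have hL : ((Nat.clog 2 k : ℕ) : ℝ) ≤ 4 * Real.log k := by
      have h4 : 2 ^ (Nat.clog 2 k - 1) < k := Nat.pow_pred_clog_lt_self (by norm_num) hk
      have h5 : 1 ≤ Nat.clog 2 k := Nat.clog_pos (by norm_num) hk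
      have h6 : Real.log (2 ^ (Nat.clog 2 k - 1)) ≤ Real.log k :=
        Real.log_le_log (by positivity) (by exact_mod_cast h4.le)
      rw [Real.log_pow, Nat.cast_sub h5] at h6
      push_cast at h6
      have h7 : (1 : ℝ) ≤ Nat.clog 2 k := by exact_mod_cast h5
      nlinarith
    have h4 : (4 + 32 * (Nat.clog 2 k : ℝ)) * c ≤ 136 * Real.log k * c :=
      mul_le_mul_of_nonneg_right (by linarith) hc
    have h5 : 1 * p ≤ 136 * Real.log k * p := mul_le_mul_of_nonneg_right (by linarith) hpen
    linarith
  -- With `k = 1` the claimed bound is `0`. All requests sit at the root, so none receives a class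
  -- and no share exists.
  · have hcard : (terminals r σ).card = 1 :=
      le_antisymm hk (Finset.card_pos.2 ⟨r, hrmem⟩)
    have h2 : shareSum (run N r σ).shares (fun _ => True) = 0 := by
      refine shareSum_eq_zero fun x hx _ => ?_
      have h3 := Finset.card_le_one.1 hk _ (vertex_mem_terminals N r hx) _ hrmem
      have h4 := (shares_run_spec N r σ x hx).2.2
      rw [h3, N.dist_self] at h4
      have : (0 : ℝ) < 2 ^ x.cls := by positivity
      linarith
    rw [hcard]
    simp only [Nat.cast_one, Real.log_one]
    linarith

end Run

end PCST

end

theorem theorem5 :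
    ∃ C : ℝ, 0 < C ∧
      ∀ (V : Type*) [Fintype V] (N : PCST.Network V) (r : V),
        (PCST.costShareAlgorithm N r).Solves N r ∧
        ∀ σ : List (PCST.Request V),
          (∀ (M : Type*) [Fintype M]
            (T : PCST.HSTEmbedding (PCST.terminals r σ) N.dist M),
            (PCST.costShareAlgorithm N r).cost N σ ≤ C * T.opt r σ) ∧
          (PCST.costShareAlgorithm N r).cost N σ ≤
            C * Real.log ((PCST.terminals r σ).card : ℝ) * N.opt r σ := by
  refine ⟨272, by norm_num, fun V _ N r => ⟨PCST.costShareAlgorithm_solves N r,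
    fun σ => ⟨fun M _ T => ?_, PCST.cost_le_log_opt N r σ⟩⟩⟩
  -- The tree bound has constant `32`; as `OPT(T)` is nonnegative, it may be raised to the common
  -- `272`.
  have h1 := PCST.cost_le_opt_tree N r σ T
  have h2 : 0 ≤ T.opt r σ := PCST.opt_nonneg _ _ _
  linarith
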